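/- For integers $p,q,r,a,b,c$ let $K\left(\begin{smallmatrix}p&q&r\\a&b&c\end{smallmatrix}\right)$ be the following link diagram on the sphere $S^2$. A circle separates $S^2$ into an inner and an outer disk. The inner disk contains a Y-shaped tree with edges $A_0,A_1,A_2$ labelled $p,q,r$, and the outer disk a Y-shaped tree with edges $B_0,B_1,B_2$ labelled $a,b,c$; the six edges end on the circle in the cyclic order $A_0,B_0,A_1,B_1,A_2,B_2$. Inside each disk the diagram is the part of the boundary of a thin neighbourhood of the tree that runs along the tree, where the band along an edge with label $n$ is given $|n|$ half twists (crossings); the outer ends of the six bands are arcs into which the circle is divided, and the two parts of the diagram are glued at the six points that separate these arcs. A crossing on an edge with positive label is one whose $A$-smoothing in the Kauffman bracket cuts the band; for a negative label the $A$-smoothing leaves the band uncut. The Jones polynomial of an oriented diagram $D$ with writhe $w$ is $J_D=(-A^3)^{-w}\langle D\rangle$ with $A=t^{-1/4}$, where $\langle D\rangle$ is the Kauffman bracket with value $1$ on the crossingless diagram of the unknot. Say that $K\left(\begin{smallmatrix}p&q&r\\a&b&c\end{smallmatrix}\right)=K\left(\begin{smallmatrix}p'&q'&r'\\a'&b'&c'\end{smallmatrix}\right)$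 *by a $D_3$ symmetry* if the two arrays of labels can be transformed into each other by means of the relations $$K\left(\begin{smallmatrix}p&q&r\\a&b&c\end{smallmatrix}\right)=K\left(\begin{smallmatrix}q&r&p\\b&c&a\end{smallmatrix}\right),\qquad K\left(\begin{smallmatrix}p&q&r\\a&b&c\end{smallmatrix}\right)=K\left(\begin{smallmatrix}p&r&q\\c&b&a\end{smallmatrix}\right).$$ **Lemma.** Let $p,q,r,a,b,c$ be even integers (of any sign, possibly zero), let $\tau\in S_3$ be a transposition, and let $(\tau(a),\tau(b),\tau(c))$ be the triple obtained from $(a,b,c)$ by permuting its three positions by $\tau$. Then, for any choice of orientations of the two diagrams, $$J_{K\left(\begin{smallmatrix}p&q&r\\a&b&c\end{smallmatrix}\right)}=J_{K\left(\begin{smallmatrix}p&q&r\\\tau(a)&\tau(b)&\tau(c)\end{smallmatrix}\right)}$$ if and only if $$K\left(\begin{smallmatrix}p&q&r\\a&b&c\end{smallmatrix}\right)=K\left(\begin{smallmatrix}p&q&r\\\tau(a)&\tau(b)&\tau(c)\end{smallmatrix}\right)$$ by a $D_3$ symmetry. -/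

import Mathlib

open scoped LaurentPolynomial

/-! ### Link diagrams, Kauffman bracket, writhe, Jones polynomial -/

/-- A link diagram given by its planar-diagram code.  The arcs of the diagram carry labels.
A crossing is recorded by the labels of its four ends, listed counterclockwise, such that the ends
numbered `0` and `2` belong to the under-strand and those numbered `1` and `3` to the over-strand.
A join records that two consecutive arcs of the curve are glued, without a crossing.
Every label occurs exactly twice.  The bracket, the writhe and the Jones polynomial only depend
on this code, so that planarity of the code is not needed to define them. -/
structure LinkDiagram where
  Crossing : Type
  Join : Type
  Label : Type
  [fintypeCrossing : Fintype Crossing]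
  [decEqCrossing : DecidableEq Crossing]
  [fintypeJoin : Fintype Join]
  cross : Crossing → Fin 4 → Label
  join : Join → Fin 2 → Label
  twice : ∀ e : Label,
    {h : (Crossing × Fin 4) ⊕ (Join × Fin 2) |
      Sum.elim (fun x => cross x.1 x.2) (fun x => join x.1 x.2) h = e}.ncard = 2

namespace LinkDiagram

attribute [instance] LinkDiagram.fintypeCrossing LinkDiagram.decEqCrossing
  LinkDiagram.fintypeJoin

/-- The ends of arcs at the crossings and at the joins. -/
abbrev End (D : LinkDiagram) : Type := (D.Crossing × Fin 4) ⊕ (D.Join × Fin 2)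

/-- The label of the arc to which an end belongs. -/
def label (D : LinkDiagram) (h : D.End) : D.Label :=
  Sum.elim (fun x => D.cross x.1 x.2) (fun x => D.join x.1 x.2) h

/-- The end to which an end of a crossing is connected in a smoothing.  `true` is the
`A`-smoothing, which merges the two regions swept out by the over-strand when it is rotated
counterclockwise (it connects `0` with `1` and `2` with `3`); `false` is the `A⁻¹`-smoothing
(it connects `0` with `3` and `1` with `2`). -/
def smoothing : Bool → Fin 4 → Fin 4
  | true => ![1, 0, 3, 2]
  | false => ![3, 2, 1, 0]

/-- Two labels are adjacent in the state `s` if they are connected at a join or at a smoothed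
crossing. -/
def StateAdj (D : LinkDiagram) (s : D.Crossing → Bool) (x y : D.Label) : Prop :=
  (∃ j, x = D.join j 0 ∧ y = D.join j 1) ∨
    ∃ c k, x = D.cross c k ∧ y = D.cross c (smoothing (s c) k)

/-- The number of closed curves of the state `s`. -/
noncomputable def loops (D : LinkDiagram) (s : D.Crossing → Bool) : ℕ :=
  Nat.card (Quot (D.StateAdj s))

/-- The Kauffman bracket, a Laurent polynomial in `A = T 1`, by its state sum; the bracket of a
crossingless diagram of the unknot is `1`. -/
noncomputable def bracket (D : LinkDiagram) : ℤ[T;T⁻¹] :=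
  ∑ s : D.Crossing → Bool,
    LaurentPolynomial.T (∑ c, if s c then 1 else -1) *
      (-LaurentPolynomial.T 2 - LaurentPolynomial.T (-2)) ^ (D.loops s - 1)

/-- An orientation of the link: `inward h` tells whether the curve runs through the end `h`
into the crossing or join at that end (and not out of it). -/
structure Orientation (D : LinkDiagram) where
  inward : D.End → Bool
  through_crossing : ∀ c k, inward (Sum.inl (c, k + 2)) = !inward (Sum.inl (c, k))
  through_join : ∀ j, inward (Sum.inr (j, 1)) = !inward (Sum.inr (j, 0))
  along_arc : ∀ h h', h ≠ h' → D.label h = D.label h' → inward h' = !inward h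

/-- The sign of a crossing.  It is positive if the under-strand enters at `0` and the over-strand
at `3`, or the under-strand at `2` and the over-strand at `1`. -/
def sign (D : LinkDiagram) (o : D.Orientation) (c : D.Crossing) : ℤ :=
  if o.inward (Sum.inl (c, 0)) = o.inward (Sum.inl (c, 3)) then 1 else -1

/-- The writhe of an oriented link diagram. -/
def writhe (D : LinkDiagram) (o : D.Orientation) : ℤ := ∑ c, D.sign o c

/-- The Jones polynomial of an oriented link diagram, as a Laurent polynomial in `t ^ (1/4) = T 1`:
it is `(-A ^ 3) ^ (-w) * ⟨D⟩`, where `w` is the writhe, evaluated at `A = t ^ (-1/4)`. -/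
noncomputable def jones (D : LinkDiagram) (o : D.Orientation) : ℤ[T;T⁻¹] :=
  LaurentPolynomial.invert
    (LaurentPolynomial.C (((D.writhe o).negOnePow : ℤˣ) : ℤ) *
      LaurentPolynomial.T (-3 * D.writhe o) * D.bracket)

/-- The other end of the strand that passes a crossing or join. -/
def across (D : LinkDiagram) : D.End → D.End
  | Sum.inl (c, k) => Sum.inl (c, k + 2)
  | Sum.inr (j, k) => Sum.inr (j, k + 1)

theorem across_across (D : LinkDiagram) (h : D.End) : D.across (D.across h) = h := by
  rcases h with ⟨c, k⟩ | ⟨j, k⟩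
  · simp only [across]; fin_cases k <;> rfl
  · simp only [across]; fin_cases k <;> rfl

theorem across_ne (D : LinkDiagram) (h : D.End) : D.across h ≠ h := by
  rcases h with ⟨c, k⟩ | ⟨j, k⟩
  · simp only [across]; fin_cases k <;> simp
  · simp only [across]; fin_cases k <;> simp

theorem exists_partner (D : LinkDiagram) (h : D.End) :
    ∃ h', h' ≠ h ∧ ∀ x, D.label x = D.label h ↔ x = h ∨ x = h' := by
  obtain ⟨x, y, hxy, hs⟩ := Set.ncard_eq_two.1 (D.twice (D.label h))
  have key : ∀ z, D.label z = D.label h ↔ z = x ∨ z = y := fun z => by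
    have := Set.ext_iff.1 hs z
    simpa [label] using this
  rcases (key h).1 rfl with rfl | rfl
  · exact ⟨y, hxy.symm, key⟩
  · exact ⟨x, hxy, fun z => (key z).trans or_comm⟩

/-- Two fixed-point-free involutions admit a common two-colouring. -/
theorem exists_colouring {X : Type} (f g : X → X) (hf : ∀ x, f (f x) = x) (hg : ∀ x, g (g x) = x)
    (hf' : ∀ x, f x ≠ x) (hg' : ∀ x, g x ≠ x) :
    ∃ c : X → Bool, (∀ x, c (f x) = !c x) ∧ ∀ x, c (g x) = !c x := by
  let F : Equiv.Perm X := ⟨f, f, hf, hf⟩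
  let G : Equiv.Perm X := ⟨g, g, hg, hg⟩
  have hFF : F * F = 1 := Equiv.ext hf
  have hGG : G * G = 1 := Equiv.ext hg
  let S : Equiv.Perm X := F * G
  have hGi : G⁻¹ = G := inv_eq_of_mul_eq_one_left hGG
  have hFi : F⁻¹ = F := inv_eq_of_mul_eq_one_left hFF
  have hS : S⁻¹ = G * F := by simp [S, hGi, hFi]
  have hGS : G * S * G⁻¹ = S⁻¹ := by rw [hS, hGi]; simp only [S, mul_assoc, hGG, mul_one]
  have hconj : ∀ k : ℤ, G * S ^ k = S ^ (-k) * G := fun k => by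
    have := conj_zpow (i := k) (a := G) (b := S)
    rw [hGS, inv_zpow', eq_mul_inv_iff_mul_eq] at this
    exact this.symm
  have hno : ∀ (x : X) (k : ℤ), (S ^ k) x ≠ g x := by
    intro x k hk
    rcases Int.even_or_odd' k with ⟨m, rfl | rfl⟩
    · apply hg' ((S ^ m) x)
      have h1 : (G * S ^ m) x = (S ^ (-m) * G) x := by rw [hconj]
      have h2 : (G * S ^ m) x = (S ^ (-m) * S ^ (2 * m)) x := by
        rw [h1]; simp only [Equiv.Perm.mul_apply, hk]; rfl
      rw [← zpow_add] at h2
      rw [show -m + 2 * m = m by ring] at h2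
      exact h2
    · apply hf' ((S ^ (m + 1)) x)
      have h3 : F * S ^ (m + 1) = S ^ (-m) * G := by
        rw [← hconj, zpow_add, zpow_one, ← (Commute.refl S).zpow_right m |>.eq]
        simp only [S, ← mul_assoc, hFF, one_mul]
      have h1 : (F * S ^ (m + 1)) x = (S ^ (-m) * G) x := by rw [h3]
      have h2 : (F * S ^ (m + 1)) x = (S ^ (-m) * S ^ (2 * m + 1)) x := by
        rw [h1]; simp only [Equiv.Perm.mul_apply, hk]; rfl
      rw [← zpow_add] at h2
      rw [show -m + (2 * m + 1) = m + 1 by ring] at h2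
      exact h2
  let r : Setoid X := Equiv.Perm.SameCycle.setoid S
  have hr : ∀ x y, x ≈ y ↔ ∃ k : ℤ, (S ^ k) x = y := fun x y => Iff.rfl
  let q : X → Quotient r := fun x => Quotient.mk r x
  have hlift : ∀ x y, x ≈ y → q (g x) = q (g y) := by
    rintro x y ⟨k, rfl⟩
    refine Quotient.sound ((hr _ _).2 ⟨-k, ?_⟩)
    have : (G * S ^ k) x = (S ^ (-k) * G) x := by rw [hconj]
    exact this.symm
  let φ : Quotient r → Quotient r := Quotient.lift (fun x => q (g x)) hlift
  have hφq : ∀ x, φ (q x) = q (g x) := fun x => rfl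
  have hφφ : ∀ z, φ (φ z) = z := fun z => Quotient.inductionOn z fun x => by
    change q (g (g x)) = q x
    rw [hg]
  have hφ : ∀ z, φ z ≠ z := fun z => Quotient.inductionOn z fun x h => by
    obtain ⟨k, hk⟩ := (hr _ _).1 (Quotient.exact (h : q (g x) = q x).symm)
    exact hno x k hk
  have hfg : ∀ x, q (f x) = q (g x) := fun x => by
    refine (Quotient.sound ((hr _ _).2 ⟨1, ?_⟩)).symm
    simp only [zpow_one, S, Equiv.Perm.mul_apply]
    exact congrArg f (hg x)
  classical
  let _ : LinearOrder (Quotient r) := linearOrderOfSTO (WellOrderingRel (α := Quotient r))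
  have hc : ∀ z, decide (φ z < φ (φ z)) = !decide (z < φ z) := fun z => by
    rw [hφφ]
    rcases lt_or_gt_of_ne (hφ z) with h | h
    · simp [h, h.le]
    · simp [h, h.le]
  refine ⟨fun x => decide (q x < φ (q x)), fun x => ?_, fun x => ?_⟩
  · simp only [hfg, ← hφq]; exact hc _
  · simp only [← hφq]; exact hc _

/-- Every link diagram has an orientation. -/
theorem nonempty_orientation (D : LinkDiagram) : Nonempty D.Orientation := by
  choose p hp hlab using D.exists_partner
  have hpp : ∀ h, p (p h) = h := fun h => by
    have h1 : D.label (p h) = D.label h := (hlab h _).2 (Or.inr rfl)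
    rcases (hlab (p h) h).1 h1.symm with h2 | h2
    · exact absurd h2.symm (hp h)
    · exact h2.symm
  obtain ⟨c, hc, hc'⟩ := exists_colouring D.across p D.across_across hpp D.across_ne hp
  refine ⟨⟨c, fun x k => hc (Sum.inl (x, k)), fun j => hc (Sum.inr (j, 0)), fun h h' hne he => ?_⟩⟩
  rcases (hlab h h').1 he.symm with h1 | h1
  · exact absurd h1.symm hne
  · rw [h1]; exact hc' h

end LinkDiagram

/-! ### The diagrams of girth three -/

/-- The array of edge labels of a pair of Y-shaped trees: `p, q, r` belong to the inner tree and
`a, b, c` to the outer tree. -/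
@[ext] structure TreeLabels where
  p : ℤ
  q : ℤ
  r : ℤ
  a : ℤ
  b : ℤ
  c : ℤ

namespace TreeLabels

/-- The six edges of the two trees. -/
abbrev Edge : Type := Fin 3 ⊕ Fin 3

/-- The number of half twists on an edge, with its sign. -/
def twist (L : TreeLabels) : Edge → ℤ := Sum.elim ![L.p, L.q, L.r] ![L.a, L.b, L.c]

/-- The number of crossings on an edge. -/
def len (L : TreeLabels) (e : Edge) : ℕ := (L.twist e).natAbs

/-- The band along an edge `e` is cut, at its two ends and between consecutive crossings, into
levels `0, …, L.len e`, where level `0` is next to the centre of the tree and level `L.len e` is on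
the circle that separates the two trees.  An arc of the diagram is given by an edge, a level and a
side: `true` is the left and `false` the right side, seen in the direction from the centre of the
tree to the circle. -/
abbrev Arc (L : TreeLabels) : Type := (Σ e : Edge, Fin (L.len e + 1)) × Bool

/-- The crossing number `j` on an edge lies between levels `j` and `j + 1`.  Its ends are listed
counterclockwise.  If the label of the edge is positive, the under-strand starts at the left side
of level `j`, so that the `A`-smoothing cuts the band; if the label is negative, the under-strand
starts at the right side of level `j`, so that the `A`-smoothing leaves the band uncut. -/
def crossArc (L : TreeLabels) (x : Σ e : Edge, Fin (L.len e)) (k : Fin 4) : L.Arc :=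
  ![(⟨x.1, x.2.castSucc⟩, true), (⟨x.1, x.2.castSucc⟩, false),
    (⟨x.1, x.2.succ⟩, false), (⟨x.1, x.2.succ⟩, true)] (if 0 < L.twist x.1 then k else k + 1)

/-- The joins.  The edges `A₀, A₁, A₂` of the inner tree and `B₀, B₁, B₂` of the outer tree end on
the separating circle in the counterclockwise order `A₀, B₀, A₁, B₁, A₂, B₂`.  The joins are, in
this order: around the centre of the inner tree, around the centre of the outer tree, and (two
families) on the separating circle. -/
def joinArc (L : TreeLabels) : Fin 4 × Fin 3 → Fin 2 → L.Arc := fun x =>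
  match x with
  | (0, i) => ![(⟨Sum.inl i, 0⟩, true), (⟨Sum.inl (i + 1), 0⟩, false)]
  | (1, i) => ![(⟨Sum.inr i, 0⟩, false), (⟨Sum.inr (i + 1), 0⟩, true)]
  | (2, i) => ![(⟨Sum.inl i, Fin.last _⟩, true), (⟨Sum.inr i, Fin.last _⟩, true)]
  | (3, i) => ![(⟨Sum.inr i, Fin.last _⟩, false), (⟨Sum.inl (i + 1), Fin.last _⟩, false)]

/-- The arc at an end. -/
def endArc (L : TreeLabels) :
    ((Σ e : Edge, Fin (L.len e)) × Fin 4) ⊕ ((Fin 4 × Fin 3) × Fin 2) → L.Arc :=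
  Sum.elim (fun x => L.crossArc x.1 x.2) (fun x => L.joinArc x.1 x.2)

/-- The join at an arc of level `0`. -/
def lowJoin : Edge → Bool → (Fin 4 × Fin 3) × Fin 2
  | Sum.inl k, true => ((0, k), 0)
  | Sum.inl k, false => ((0, k - 1), 1)
  | Sum.inr k, false => ((1, k), 0)
  | Sum.inr k, true => ((1, k - 1), 1)

/-- The join at an arc of the highest level. -/
def highJoin : Edge → Bool → (Fin 4 × Fin 3) × Fin 2
  | Sum.inl k, true => ((2, k), 0)
  | Sum.inl k, false => ((3, k - 1), 1)
  | Sum.inr k, false => ((3, k), 0)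
  | Sum.inr k, true => ((2, k), 1)

/-- The end of an arc that points to the centre of the tree. -/
def lowEnd (L : TreeLabels) (x : L.Arc) :
    ((Σ e : Edge, Fin (L.len e)) × Fin 4) ⊕ ((Fin 4 × Fin 3) × Fin 2) :=
  if h : x.1.2 = 0 then Sum.inr (lowJoin x.1.1 x.2)
  else Sum.inl (⟨x.1.1, x.1.2.pred h⟩,
    (if x.2 then 3 else 2) - (if 0 < L.twist x.1.1 then 0 else 1))

/-- The end of an arc that points to the separating circle. -/
def highEnd (L : TreeLabels) (x : L.Arc) :
    ((Σ e : Edge, Fin (L.len e)) × Fin 4) ⊕ ((Fin 4 × Fin 3) × Fin 2) :=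
  if h : x.1.2 = Fin.last _ then Sum.inr (highJoin x.1.1 x.2)
  else Sum.inl (⟨x.1.1, x.1.2.castPred h⟩,
    (if x.2 then 0 else 1) - (if 0 < L.twist x.1.1 then 0 else 1))

theorem endArc_lowEnd (L : TreeLabels) (x : L.Arc) : L.endArc (L.lowEnd x) = x := by
  obtain ⟨⟨e, i⟩, s⟩ := x
  by_cases h : i = 0
  · subst h
    rcases e with k | k <;> cases s <;> fin_cases k <;> rfl
  · simp only [lowEnd, h, dite_false, endArc, Sum.elim_inl, crossArc]
    by_cases ht : 0 < L.twist e <;> cases s <;> simp [ht]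

theorem endArc_highEnd (L : TreeLabels) (x : L.Arc) : L.endArc (L.highEnd x) = x := by
  obtain ⟨⟨e, i⟩, s⟩ := x
  by_cases h : i = Fin.last _
  · subst h
    simp only [highEnd, dite_true]
    rcases e with k | k <;> cases s <;> fin_cases k <;> rfl
  · simp only [highEnd, h, dite_false, endArc, Sum.elim_inl, crossArc]
    by_cases ht : 0 < L.twist e <;> cases s <;> simp [ht]

theorem eq_lowEnd_or_highEnd (L : TreeLabels)
    (h : ((Σ e : Edge, Fin (L.len e)) × Fin 4) ⊕ ((Fin 4 × Fin 3) × Fin 2)) :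
    h = L.lowEnd (L.endArc h) ∨ h = L.highEnd (L.endArc h) := by
  rcases h with ⟨⟨e, j⟩, k⟩ | ⟨⟨m, i⟩, k⟩
  · have h1 : ∀ s, L.lowEnd (⟨e, j.succ⟩, s) = Sum.inl (⟨e, j⟩,
        (if s then 3 else 2) - (if 0 < L.twist e then 0 else 1)) := fun s => by
      simp [lowEnd]
    have h2 : ∀ s, L.highEnd (⟨e, j.castSucc⟩, s) = Sum.inl (⟨e, j⟩,
        (if s then 0 else 1) - (if 0 < L.twist e then 0 else 1)) := fun s => by
      simp [highEnd, Fin.castSucc_ne_last]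
    by_cases ht : 0 < L.twist e <;> simp only [ht, if_true, if_false] at h1 h2 <;>
      simp only [endArc, Sum.elim_inl, crossArc, ht, if_true, if_false] <;> fin_cases k
    · exact Or.inr (h2 true).symm
    · exact Or.inr (h2 false).symm
    · exact Or.inl (h1 false).symm
    · exact Or.inl (h1 true).symm
    · exact Or.inr (h2 false).symm
    · exact Or.inl (h1 false).symm
    · exact Or.inl (h1 true).symm
    · exact Or.inr (h2 true).symm
  · have h1 : ∀ e s, L.lowEnd (⟨e, 0⟩, s) = Sum.inr (lowJoin e s) := fun e s => by simp [lowEnd]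
    have h2 : ∀ e s, L.highEnd (⟨e, Fin.last _⟩, s) = Sum.inr (highJoin e s) := fun e s => by
      simp [highEnd]
    fin_cases m <;> fin_cases k <;> simp [endArc, joinArc, h1, h2, lowJoin, highJoin]

theorem lowEnd_ne_highEnd (L : TreeLabels) (x : L.Arc) : L.lowEnd x ≠ L.highEnd x := by
  obtain ⟨⟨e, i⟩, s⟩ := x
  by_cases h : i = 0 <;> by_cases h' : i = Fin.last _
  · simp only [lowEnd, highEnd, h, dite_true]
    rw [dif_pos (h.symm.trans h')]
    rcases e with k | k <;> cases s <;> simp [lowJoin, highJoin]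
  · simp only [lowEnd, highEnd, h, dite_true]
    rw [dif_neg (fun h2 => h' (h.trans h2))]
    simp
  · simp only [highEnd, h', dite_true]
    simp only [lowEnd]
    rw [dif_neg (fun h2 => h (h'.trans h2))]
    simp
  · simp only [lowEnd, highEnd, h, h', dite_false, ne_eq, Sum.inl.injEq, Prod.mk.injEq, not_and]
    intro _
    cases s <;> simp

/-- The link diagram of girth three with the given edge labels. -/
def diagram (L : TreeLabels) : LinkDiagram where
  Crossing := Σ e : Edge, Fin (L.len e)
  Join := Fin 4 × Fin 3
  Label := L.Arc
  cross := L.crossArc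
  join := L.joinArc
  twice := fun x => by
    refine Set.ncard_eq_two.2 ⟨L.lowEnd x, L.highEnd x, L.lowEnd_ne_highEnd x, ?_⟩
    ext h
    simp only [Set.mem_ofPred_eq, Set.mem_insert_iff, Set.mem_singleton_iff]
    constructor
    · rintro rfl
      exact L.eq_lowEnd_or_highEnd h
    · rintro (rfl | rfl)
      · exact L.endArc_lowEnd x
      · exact L.endArc_highEnd x

/-- The two generating symmetries: the rotation by a third of a full turn, and the reflection. -/
inductive D3Step : TreeLabels → TreeLabels → Prop
  | rotation (p q r a b c : ℤ) : D3Step ⟨p, q, r, a, b, c⟩ ⟨q, r, p, b, c, a⟩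
  | reflection (p q r a b c : ℤ) : D3Step ⟨p, q, r, a, b, c⟩ ⟨p, r, q, c, b, a⟩

/-- Two diagrams are equal by a `D₃` symmetry if they are interchangeable by the rotation and
reflection relations, that is, related by the equivalence relation which these generate. -/
def EqByD3 : TreeLabels → TreeLabels → Prop := Relation.EqvGen D3Step

end TreeLabels

/-! Write A = `T 1` and δ = `loopValue` = -A² - A⁻². For even labels the two sides of every band run
in opposite directions, so each crossing has the sign of its label and the writhe is the sum of the
labels (`writhe_eq`). A permutation of labels keeps this sum, so the Jones polynomials agree exactly
when the brackets do.

In a state, k ≥ 1 cuts in one band split off k - 1 circles; the other curves depend only on which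
bands are cut at all (`loops_eq`). The bracket is thus a sum over 64 patterns of cut bands, with a
weight `bandSum n x` for each band and a power of δ (`bracket_eq`). That power depends only on the
numbers of cut inner and cut outer bands, with one exception (`bandLoops`): one inner and one outer
cut give δ² if the two bands are opposite on the circle, and 1 otherwise. Up to terms symmetric in
a, b, c, the bracket is therefore δ² - 1 times the product of the uncut weights times x_p x_b + x_q
x_c + x_r x_a, where x_n is the cut weight of n divided by the uncut one. Exchanging two outer
labels changes the last sum by a product such as (x_p - x_r)(x_b - x_a). Since δ x_n = A^(4n) - 1
for even n, x_n determines n (`bandSum_cross_eq_iff`), and the product vanishes iff p = r or a = b.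

The sum with the labels themselves, pb + qc + ra, is invariant under the D₃ relations
(`EqByD3.sum_mul_eq`), so a D₃ symmetry forces the same alternative. Conversely, if p = r, the
reflection that exchanges these two inner edges realises the transposition. -/

namespace TreeLabels

/-! ### The writhe -/

theorem lowEnd_zero (L : TreeLabels) (e : Edge) (t : Bool) :
    L.lowEnd (⟨e, 0⟩, t) = Sum.inr (lowJoin e t) := by simp [lowEnd]

theorem highEnd_last (L : TreeLabels) (e : Edge) (t : Bool) :
    L.highEnd (⟨e, Fin.last _⟩, t) = Sum.inr (highJoin e t) := by simp [highEnd]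

theorem lowEnd_succ (L : TreeLabels) (e : Edge) (j : Fin (L.len e)) (t : Bool) :
    L.lowEnd (⟨e, j.succ⟩, t) =
      Sum.inl (⟨e, j⟩, (if t then 3 else 2) - (if 0 < L.twist e then 0 else 1)) := by
  simp [lowEnd]

theorem highEnd_castSucc (L : TreeLabels) (e : Edge) (j : Fin (L.len e)) (t : Bool) :
    L.highEnd (⟨e, j.castSucc⟩, t) =
      Sum.inl (⟨e, j⟩, (if t then 0 else 1) - (if 0 < L.twist e then 0 else 1)) := by
  simp [highEnd, Fin.castSucc_ne_last]

/-- The orientation of the curve at an end of an arc, with the ends spelt out. -/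
def inwardAt (L : TreeLabels) (o : L.diagram.Orientation)
    (h : ((Σ e : Edge, Fin (L.len e)) × Fin 4) ⊕ ((Fin 4 × Fin 3) × Fin 2)) : Bool :=
  o.inward h

theorem inwardAt_crossing (L : TreeLabels) (o : L.diagram.Orientation)
    (c : Σ e : Edge, Fin (L.len e)) (k : Fin 4) :
    L.inwardAt o (Sum.inl (c, k + 2)) = !L.inwardAt o (Sum.inl (c, k)) :=
  o.through_crossing c k

theorem inwardAt_join (L : TreeLabels) (o : L.diagram.Orientation) (m : Fin 4 × Fin 3) :
    L.inwardAt o (Sum.inr (m, 1)) = !L.inwardAt o (Sum.inr (m, 0)) :=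
  o.through_join m

/-- Whether an arc is oriented from the centre of its tree towards the separating circle. -/
def outward (L : TreeLabels) (o : L.diagram.Orientation) (x : L.Arc) : Bool :=
  L.inwardAt o (L.highEnd x)

theorem inwardAt_lowEnd (L : TreeLabels) (o : L.diagram.Orientation) (x : L.Arc) :
    L.inwardAt o (L.lowEnd x) = !L.outward o x :=
  o.along_arc (L.highEnd x) (L.lowEnd x) (L.lowEnd_ne_highEnd x).symm
    ((L.endArc_highEnd x).trans (L.endArc_lowEnd x).symm)

/-- Each strand of a crossing changes the side of the band and keeps its direction along the band.
-/
theorem outward_succ (L : TreeLabels) (o : L.diagram.Orientation) (e : Edge)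
    (j : Fin (L.len e)) (t : Bool) :
    L.outward o (⟨e, j.succ⟩, t) = L.outward o (⟨e, j.castSucc⟩, !t) := by
  have h := L.inwardAt_crossing o ⟨e, j⟩
    ((if !t then 0 else 1) - (if 0 < L.twist e then 0 else 1))
  have h1 := L.inwardAt_lowEnd o (⟨e, j.succ⟩, t)
  rw [lowEnd_succ] at h1
  rw [← Bool.not_inj_iff, ← h1, outward, highEnd_castSucc, ← h]
  congr 3
  by_cases ht : 0 < L.twist e <;> cases t <;> simp only [ht] <;> rfl

theorem outward_level (L : TreeLabels) (o : L.diagram.Orientation) (e : Edge)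
    (i : Fin (L.len e + 1)) (t : Bool) :
    L.outward o (⟨e, i⟩, t) = L.outward o (⟨e, 0⟩, t ^^ decide (Odd (i : ℕ))) := by
  induction i using Fin.induction generalizing t with
  | zero => simp
  | succ j ih =>
    rw [outward_succ, ih]
    congr 2
    by_cases h : Odd (j : ℕ) <;> cases t <;> simp [h, Nat.odd_add_one]

/-- An even number of crossings brings each strand back to its own side. -/
theorem outward_last (L : TreeLabels) (o : L.diagram.Orientation) (e : Edge)
    (he : Even (L.twist e)) (t : Bool) :
    L.outward o (⟨e, Fin.last _⟩, t) = L.outward o (⟨e, 0⟩, t) := by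
  rw [outward_level]
  simp [len, Int.not_odd_iff_even.2 he]

theorem outward_lowJoin (L : TreeLabels) (o : L.diagram.Orientation) (e e' : Edge) (t t' : Bool)
    (m : Fin 4 × Fin 3) (h : lowJoin e t = (m, 0)) (h' : lowJoin e' t' = (m, 1)) :
    L.outward o (⟨e, 0⟩, t) = !L.outward o (⟨e', 0⟩, t') := by
  rw [← Bool.not_inj_iff, ← inwardAt_lowEnd, ← inwardAt_lowEnd, lowEnd_zero, lowEnd_zero, h, h',
    inwardAt_join, Bool.not_not]

theorem outward_highJoin (L : TreeLabels) (o : L.diagram.Orientation)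
    (heven : ∀ e, Even (L.twist e)) (e e' : Edge) (t t' : Bool)
    (m : Fin 4 × Fin 3) (h : highJoin e t = (m, 0)) (h' : highJoin e' t' = (m, 1)) :
    L.outward o (⟨e, 0⟩, t) = !L.outward o (⟨e', 0⟩, t') := by
  rw [← L.outward_last o e (heven e), ← L.outward_last o e' (heven e'), outward, outward,
    highEnd_last, highEnd_last, h, h', inwardAt_join, Bool.not_not]

/-- If all labels are even, then the two sides of each band are oriented oppositely. -/
theorem outward_antiparallel (L : TreeLabels) (o : L.diagram.Orientation)
    (heven : ∀ e, Even (L.twist e)) (e : Edge) :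
    L.outward o (⟨e, 0⟩, true) = !L.outward o (⟨e, 0⟩, false) := by
  rcases e with i | i
  -- One side of the band is linked to the other through three joins: to the neighbouring band,
  -- around the centre of the other tree, and back. Each join exchanges inward and outward, and
  -- three is odd.
  · have h1 := L.outward_highJoin o heven (Sum.inr (i - 1)) (Sum.inl i) false false (3, i - 1)
      rfl rfl
    have h2 := L.outward_lowJoin o (Sum.inr (i - 1)) (Sum.inr i) false true (1, i - 1) rfl rfl
    have h3 := L.outward_highJoin o heven (Sum.inl i) (Sum.inr i) true true (2, i) rfl rfl
    rw [h3, ← h2, h1]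
  · have h1 := L.outward_highJoin o heven (Sum.inr i) (Sum.inl (i + 1)) false false (3, i) rfl
      (by simp [highJoin])
    have h2 := L.outward_lowJoin o (Sum.inl i) (Sum.inl (i + 1)) true false (0, i) rfl
      (by simp [lowJoin])
    have h3 := L.outward_highJoin o heven (Sum.inl i) (Sum.inr i) true true (2, i) rfl rfl
    rw [h1, ← h2, h3, Bool.not_not]

theorem outward_antiparallel_level (L : TreeLabels) (o : L.diagram.Orientation)
    (heven : ∀ e, Even (L.twist e)) (e : Edge) (i : Fin (L.len e + 1)) :
    L.outward o (⟨e, i⟩, true) = !L.outward o (⟨e, i⟩, false) := by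
  rw [outward_level, outward_level _ _ _ _ false]
  by_cases h : Odd (i : ℕ) <;> simp [h, L.outward_antiparallel o heven e]

/-- Once the sides are antiparallel, the sign only depends on which strand is over, and the label
decides this. -/
theorem sign_eq (L : TreeLabels) (o : L.diagram.Orientation)
    (heven : ∀ e, Even (L.twist e)) (e : Edge) (j : Fin (L.len e)) :
    L.diagram.sign o ⟨e, j⟩ = (L.twist e).sign := by
  have h0 : L.twist e ≠ 0 := fun h => by
    have := j.2
    simp [len, h] at this
  have hs : L.diagram.sign o ⟨e, j⟩ = if L.inwardAt o (Sum.inl (⟨e, j⟩, 0)) =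
    L.inwardAt o (Sum.inl (⟨e, j⟩, 3)) then 1 else -1 := rfl
  have ha := L.outward_antiparallel_level o heven e j.castSucc
  rw [hs]
  by_cases ht : 0 < L.twist e
  -- For a positive label, the ends 0 and 3 are the lower and the upper end on the left side.
  · have h1 := L.inwardAt_lowEnd o (⟨e, j.succ⟩, true)
    rw [outward_succ, lowEnd_succ, Bool.not_true, ← ha, outward, highEnd_castSucc] at h1
    simp only [ht, if_true, sub_zero] at h1
    rw [Int.sign_eq_one_of_pos ht, if_pos h1.symm]
  -- For a negative label, the ends 3 and 0 are the left and the right end on the lower level.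
  · simp only [outward, highEnd_castSucc, ht, if_true, if_false] at ha
    rw [Int.sign_eq_neg_one_of_neg (lt_of_le_of_ne (not_lt.1 ht) h0)]
    refine if_neg fun h => ?_
    change L.inwardAt o (Sum.inl (⟨e, j⟩, 3)) = !L.inwardAt o (Sum.inl (⟨e, j⟩, 0)) at ha
    rw [h] at ha
    simp at ha

/-- If all labels are even, then the writhe is the sum of the labels. -/
theorem writhe_eq (L : TreeLabels) (o : L.diagram.Orientation)
    (heven : ∀ e, Even (L.twist e)) : L.diagram.writhe o = ∑ e, L.twist e := by
  have h : L.diagram.writhe o = ∑ c : Σ e : Edge, Fin (L.len e), (L.twist c.1).sign :=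
    Finset.sum_congr rfl fun c _ => L.sign_eq o heven c.1 c.2
  rw [h, Fintype.sum_sigma]
  refine Finset.sum_congr rfl fun e _ => ?_
  change ∑ _j : Fin (L.len e), (L.twist e).sign = _
  rw [Finset.sum_const, Finset.card_univ, Fintype.card_fin, nsmul_eq_mul, len, mul_comm,
    Int.sign_mul_natAbs]

end TreeLabels

/-! ### The regions of a band with cuts -/

/-- The number of cuts before level `i` of a band. -/
def cutsBefore {n : ℕ} (b : Fin n → Bool) (i : Fin (n + 1)) : ℕ :=
  (Finset.univ.filter fun j : Fin n => b j = true ∧ j.castSucc < i).card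

/-- The number of cuts of a band. -/
def cuts {n : ℕ} (b : Fin n → Bool) : ℕ := (Finset.univ.filter fun j : Fin n => b j = true).card

theorem cutsBefore_zero {n : ℕ} (b : Fin n → Bool) : cutsBefore b 0 = 0 := by
  simp [cutsBefore]

theorem cutsBefore_last {n : ℕ} (b : Fin n → Bool) : cutsBefore b (Fin.last n) = cuts b := by
  simp [cutsBefore, cuts, Fin.castSucc_lt_last]

theorem cutsBefore_mono {n : ℕ} (b : Fin n → Bool) {i i' : Fin (n + 1)} (h : i ≤ i') :
    cutsBefore b i ≤ cutsBefore b i' := by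
  refine Finset.card_le_card fun j hj => ?_
  simp only [Finset.mem_filter, Finset.mem_univ, true_and] at hj ⊢
  exact ⟨hj.1, hj.2.trans_le h⟩

theorem cutsBefore_le {n : ℕ} (b : Fin n → Bool) (i : Fin (n + 1)) : cutsBefore b i ≤ cuts b :=
  cutsBefore_last b ▸ cutsBefore_mono b (Fin.le_last i)

theorem cutsBefore_succ_of_cut {n : ℕ} {b : Fin n → Bool} {j : Fin n} (h : b j = true) :
    cutsBefore b j.succ = cutsBefore b j.castSucc + 1 := by
  rw [cutsBefore, cutsBefore, ← Finset.card_insert_of_notMem (a := j) (by simp)]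
  congr 1
  ext x
  simp only [Finset.mem_filter, Finset.mem_univ, true_and, Finset.mem_insert,
    Fin.castSucc_lt_succ_iff, Fin.castSucc_lt_castSucc_iff, le_iff_eq_or_lt]
  constructor
  · rintro ⟨hb, hx | hx⟩
    · exact Or.inl hx
    · exact Or.inr ⟨hb, hx⟩
  · rintro (hx | hx)
    · exact ⟨hx ▸ h, Or.inl hx⟩
    · exact ⟨hx.1, Or.inr hx.2⟩

theorem cutsBefore_succ_of_not_cut {n : ℕ} {b : Fin n → Bool} {j : Fin n} (h : b j = false) :
    cutsBefore b j.succ = cutsBefore b j.castSucc := by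
  rw [cutsBefore, cutsBefore]
  congr 1
  ext x
  simp only [Finset.mem_filter, Finset.mem_univ, true_and,
    Fin.castSucc_lt_succ_iff, Fin.castSucc_lt_castSucc_iff]
  refine and_congr_right fun hb => ⟨fun hx => lt_of_le_of_ne hx ?_, le_of_lt⟩
  rintro rfl
  simp [h] at hb

/-- A discrete intermediate value theorem: `cutsBefore` starts at 0 and rises by one exactly at the
cuts. -/
theorem exists_cut_of_lt_cutsBefore {n : ℕ} (b : Fin n → Bool) (m : ℕ) (i : Fin (n + 1))
    (h : m < cutsBefore b i) : ∃ j, b j = true ∧ cutsBefore b j.castSucc = m := by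
  induction i using Fin.induction with
  | zero => simp [cutsBefore_zero] at h
  | succ j ih =>
    cases hj : b j
    · rw [cutsBefore_succ_of_not_cut hj] at h
      exact ih h
    · rw [cutsBefore_succ_of_cut hj] at h
      rcases Nat.lt_succ_iff_lt_or_eq.1 h with h | h
      · exact ih h
      · exact ⟨j, hj, h.symm⟩

theorem exists_cut {n : ℕ} (b : Fin n → Bool) {m : ℕ} (h : m < cuts b) :
    ∃ j, b j = true ∧ cutsBefore b j.castSucc = m :=
  exists_cut_of_lt_cutsBefore b m (Fin.last n) (by rwa [cutsBefore_last])

/-- `cutsBefore` is monotone and rises at every cut, so no cut lies between two levels with the same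
value. -/
theorem eq_of_cutsBefore_eq_of_le {α : Type*} {n : ℕ} {b : Fin n → Bool} {p : Fin (n + 1) → α}
    (hp : ∀ j, b j = false → p j.castSucc = p j.succ) {i i' : Fin (n + 1)} (hi : i ≤ i')
    (h : cutsBefore b i = cutsBefore b i') : p i = p i' := by
  induction i' using Fin.induction with
  | zero => rw [Fin.le_zero_iff.1 hi]
  | succ j ih =>
    rcases hi.eq_or_lt with rfl | hi
    · rfl
    have hi' : i ≤ j.castSucc := Fin.le_castSucc_iff.2 hi
    have h1 := cutsBefore_mono b hi'
    cases hj : b j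
    · rw [← hp j hj]
      exact ih hi' (h.trans (cutsBefore_succ_of_not_cut hj))
    · rw [cutsBefore_succ_of_cut hj] at h
      omega

theorem eq_of_cutsBefore_eq {α : Type*} {n : ℕ} {b : Fin n → Bool} {p : Fin (n + 1) → α}
    (hp : ∀ j, b j = false → p j.castSucc = p j.succ) {i i' : Fin (n + 1)}
    (h : cutsBefore b i = cutsBefore b i') : p i = p i' := by
  rcases le_total i i' with hi | hi
  · exact eq_of_cutsBefore_eq_of_le hp hi h
  · exact (eq_of_cutsBefore_eq_of_le hp hi h.symm).symm

namespace TreeLabels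

/-! ### The closed curves of a state -/

/-- The strands in which a band is replaced when it is cut or left uncut, as pairs of joins. -/
def strand (S : Edge → Bool) (e : Edge) (t : Bool) : (Fin 4 × Fin 3) × (Fin 4 × Fin 3) :=
  match S e, t with
  | true, true => ((lowJoin e true).1, (lowJoin e false).1)
  | true, false => ((highJoin e true).1, (highJoin e false).1)
  | false, t => ((lowJoin e t).1, (highJoin e t).1)

/-- Two joins are adjacent if they are connected by a strand, when the bands in `S` are cut. -/
def BandAdj (S : Edge → Bool) (x y : Fin 4 × Fin 3) : Prop := ∃ e t, strand S e t = (x, y)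

/-- Whether the smoothing of a crossing cuts the band. -/
def cutAt (L : TreeLabels) (s : (Σ e : Edge, Fin (L.len e)) → Bool) (e : Edge) :
    Fin (L.len e) → Bool :=
  fun j => s ⟨e, j⟩ == decide (0 < L.twist e)

/-- The bands that are cut in a state. -/
def cutBands (L : TreeLabels) (s : (Σ e : Edge, Fin (L.len e)) → Bool) (e : Edge) : Bool :=
  decide (0 < cuts (L.cutAt s e))

/-- The adjacency of arcs in a state. -/
def ArcAdj (L : TreeLabels) (s : (Σ e : Edge, Fin (L.len e)) → Bool) (x y : L.Arc) : Prop :=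
  (∃ j, x = L.joinArc j 0 ∧ y = L.joinArc j 1) ∨
    ∃ c k, x = L.crossArc c k ∧ y = L.crossArc c (LinkDiagram.smoothing (s c) k)

theorem loops_eq_card (L : TreeLabels) (s : (Σ e : Edge, Fin (L.len e)) → Bool) :
    L.diagram.loops s = Nat.card (Quot (L.ArcAdj s)) := rfl

section

variable {L : TreeLabels} {s : (Σ e : Edge, Fin (L.len e)) → Bool}

theorem ArcAdj.of_cut_low {e : Edge} {j : Fin (L.len e)} (h : L.cutAt s e j = true) :
    L.ArcAdj s (⟨e, j.castSucc⟩, true) (⟨e, j.castSucc⟩, false) := by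
  have h' : s ⟨e, j⟩ = decide (0 < L.twist e) := by simpa [cutAt] using h
  by_cases ht : 0 < L.twist e
  · exact Or.inr ⟨⟨e, j⟩, 0, by simp [crossArc, ht], by
      simp [crossArc, ht, h', LinkDiagram.smoothing]⟩
  · exact Or.inr ⟨⟨e, j⟩, 3, by simp [crossArc, ht], by
      simp [crossArc, ht, h', LinkDiagram.smoothing]⟩

theorem ArcAdj.of_cut_high {e : Edge} {j : Fin (L.len e)} (h : L.cutAt s e j = true) :
    L.ArcAdj s (⟨e, j.succ⟩, true) (⟨e, j.succ⟩, false) := by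
  have h' : s ⟨e, j⟩ = decide (0 < L.twist e) := by simpa [cutAt] using h
  by_cases ht : 0 < L.twist e
  · exact Or.inr ⟨⟨e, j⟩, 3, by simp [crossArc, ht], by
      simp [crossArc, ht, h', LinkDiagram.smoothing]⟩
  · exact Or.inr ⟨⟨e, j⟩, 2, by simp [crossArc, ht], by
      simp [crossArc, ht, h', LinkDiagram.smoothing]⟩

theorem ArcAdj.of_not_cut {e : Edge} {j : Fin (L.len e)} (h : L.cutAt s e j = false) (t : Bool) :
    L.ArcAdj s (⟨e, j.castSucc⟩, t) (⟨e, j.succ⟩, t) := by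
  have h' : s ⟨e, j⟩ = !decide (0 < L.twist e) := by
    simp only [cutAt] at h
    cases hs : s ⟨e, j⟩ <;> cases hd : decide (0 < L.twist e) <;> simp_all
  by_cases ht : 0 < L.twist e <;> cases t
  · exact Or.inr ⟨⟨e, j⟩, 1, by simp [crossArc, ht], by
      simp [crossArc, ht, h', LinkDiagram.smoothing]⟩
  · exact Or.inr ⟨⟨e, j⟩, 0, by simp [crossArc, ht], by
      simp [crossArc, ht, h', LinkDiagram.smoothing]⟩
  · exact Or.inr ⟨⟨e, j⟩, 0, by simp [crossArc, ht], by
      simp [crossArc, ht, h', LinkDiagram.smoothing]⟩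
  · exact Or.inr ⟨⟨e, j⟩, 3, by simp [crossArc, ht], by
      simp [crossArc, ht, h', LinkDiagram.smoothing]⟩

/-- The sign of the label only renumbers the ends of a crossing. Either way, a smoothing connects
the two sides on each level or the two levels on each side, so an invariant of curves need only be
checked on these moves. -/
theorem ArcAdj.lift {α : Type*} {f : L.Arc → α} (hj : ∀ m, f (L.joinArc m 0) = f (L.joinArc m 1))
    (hl : ∀ e j, L.cutAt s e j = true →
      f (⟨e, j.castSucc⟩, true) = f (⟨e, j.castSucc⟩, false))
    (hh : ∀ e j, L.cutAt s e j = true → f (⟨e, j.succ⟩, true) = f (⟨e, j.succ⟩, false))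
    (hu : ∀ e j t, L.cutAt s e j = false → f (⟨e, j.castSucc⟩, t) = f (⟨e, j.succ⟩, t))
    {x y : L.Arc} (h : L.ArcAdj s x y) : f x = f y := by
  rcases h with ⟨m, rfl, rfl⟩ | ⟨⟨e, j⟩, k, rfl, rfl⟩
  · exact hj m
  have h1 := hl e j
  have h2 := hh e j
  have h3 := hu e j true
  have h4 := hu e j false
  by_cases ht : 0 < L.twist e <;> cases hs : s ⟨e, j⟩ <;> simp [cutAt, ht, hs] at h1 h2 h3 h4 <;>
    fin_cases k <;> simp [crossArc, LinkDiagram.smoothing, *]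

theorem mk_level_eq {e : Edge} {i i' : Fin (L.len e + 1)}
    (h : cutsBefore (L.cutAt s e) i = cutsBefore (L.cutAt s e) i') (t : Bool) :
    Quot.mk (L.ArcAdj s) (⟨e, i⟩, t) = Quot.mk (L.ArcAdj s) (⟨e, i'⟩, t) :=
  eq_of_cutsBefore_eq (p := fun i => Quot.mk (L.ArcAdj s) (⟨e, i⟩, t))
    (fun _ hj => Quot.sound (ArcAdj.of_not_cut hj t)) h

/-- A piece of a cut band is closed off by the cut at its far end or, if it is the last piece, by
the last cut. -/
theorem mk_sides_eq {e : Edge} (h : 0 < cuts (L.cutAt s e)) (i : Fin (L.len e + 1)) :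
    Quot.mk (L.ArcAdj s) (⟨e, i⟩, true) = Quot.mk (L.ArcAdj s) (⟨e, i⟩, false) := by
  rcases (cutsBefore_le (L.cutAt s e) i).lt_or_eq with h1 | h1
  · obtain ⟨j, hj, hm⟩ := exists_cut _ h1
    rw [mk_level_eq hm.symm true, mk_level_eq hm.symm false]
    exact Quot.sound (ArcAdj.of_cut_low hj)
  · obtain ⟨j, hj, hm⟩ := exists_cut (L.cutAt s e) (Nat.sub_lt h one_pos)
    have hm' : cutsBefore (L.cutAt s e) i = cutsBefore (L.cutAt s e) j.succ := by
      rw [h1, cutsBefore_succ_of_cut hj]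
      omega
    rw [mk_level_eq hm' true, mk_level_eq hm' false]
    exact Quot.sound (ArcAdj.of_cut_high hj)

end

/-- The closed curve through an arc: either it runs through joins, or it lies between two cuts of
a band. -/
def curveOf (L : TreeLabels) (s : (Σ e : Edge, Fin (L.len e)) → Bool) (x : L.Arc) :
    Quot (BandAdj (L.cutBands s)) ⊕ Σ e : Edge, Fin (cuts (L.cutAt s e) - 1) :=
  let m := cutsBefore (L.cutAt s x.1.1) x.1.2
  if h : 0 < m ∧ m < cuts (L.cutAt s x.1.1) then
    Sum.inr ⟨x.1.1, m - 1, by omega⟩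
  else Sum.inl (Quot.mk _ (if m = 0 then (lowJoin x.1.1 x.2).1 else (highJoin x.1.1 x.2).1))

theorem curveOf_congr (L : TreeLabels) (s : (Σ e : Edge, Fin (L.len e)) → Bool) {e : Edge}
    {i i' : Fin (L.len e + 1)} (t : Bool)
    (h : cutsBefore (L.cutAt s e) i = cutsBefore (L.cutAt s e) i') :
    L.curveOf s (⟨e, i⟩, t) = L.curveOf s (⟨e, i'⟩, t) := by
  simp only [curveOf, h]

theorem curveOf_low (L : TreeLabels) (s : (Σ e : Edge, Fin (L.len e)) → Bool) {e : Edge}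
    {i : Fin (L.len e + 1)} (t : Bool) (h : cutsBefore (L.cutAt s e) i = 0) :
    L.curveOf s (⟨e, i⟩, t) = Sum.inl (Quot.mk _ (lowJoin e t).1) := by
  simp [curveOf, h]

theorem curveOf_high (L : TreeLabels) (s : (Σ e : Edge, Fin (L.len e)) → Bool) {e : Edge}
    {i : Fin (L.len e + 1)} (t : Bool) (h : cutsBefore (L.cutAt s e) i = cuts (L.cutAt s e)) :
    L.curveOf s (⟨e, i⟩, t) = Sum.inl (Quot.mk _ (highJoin e t).1) := by
  by_cases h0 : cuts (L.cutAt s e) = 0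
  -- In an uncut band the highest level also has cut count 0, so `curveOf` returns the join at the
  -- centre; the strand along the band identifies it with the join on the circle.
  · rw [curveOf_low L s t (h.trans h0)]
    exact congrArg _ (Quot.sound ⟨e, t, by simp [strand, cutBands, h0]⟩)
  · simp [curveOf, h, h0]

theorem curveOf_sides (L : TreeLabels) (s : (Σ e : Edge, Fin (L.len e)) → Bool) {e : Edge}
    (i : Fin (L.len e + 1)) (h : 0 < cuts (L.cutAt s e)) :
    L.curveOf s (⟨e, i⟩, true) = L.curveOf s (⟨e, i⟩, false) := by
  have hb : L.cutBands s e = true := by simp [cutBands, h]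
  by_cases h0 : cutsBefore (L.cutAt s e) i = 0
  · rw [curveOf_low L s _ h0, curveOf_low L s _ h0]
    exact congrArg _ (Quot.sound ⟨e, true, by simp [strand, hb]⟩)
  by_cases h1 : cutsBefore (L.cutAt s e) i = cuts (L.cutAt s e)
  · rw [curveOf_high L s _ h1, curveOf_high L s _ h1]
    exact congrArg _ (Quot.sound ⟨e, false, by simp [strand, hb]⟩)
  · have h2 := cutsBefore_le (L.cutAt s e) i
    have h3 : 0 < cutsBefore (L.cutAt s e) i ∧
      cutsBefore (L.cutAt s e) i < cuts (L.cutAt s e) := by omega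
    simp only [curveOf, dif_pos h3]

theorem curveOf_joinArc (L : TreeLabels) (s : (Σ e : Edge, Fin (L.len e)) → Bool)
    (m : Fin 4 × Fin 3) (k : Fin 2) :
    L.curveOf s (L.joinArc m k) = Sum.inl (Quot.mk _ m) := by
  obtain ⟨m, i⟩ := m
  have hl := fun (e : Edge) t => L.curveOf_low s (e := e) t (cutsBefore_zero _)
  have hh := fun (e : Edge) t => L.curveOf_high s (e := e) t (cutsBefore_last _)
  fin_cases m <;> fin_cases k <;> simp [joinArc, hl, hh, lowJoin, highJoin]

theorem curveOf_sound (L : TreeLabels) (s : (Σ e : Edge, Fin (L.len e)) → Bool) {x y : L.Arc}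
    (h : L.ArcAdj s x y) : L.curveOf s x = L.curveOf s y := by
  have hpos : ∀ e j, L.cutAt s e j = true → 0 < cuts (L.cutAt s e) := fun e j hj =>
    Finset.card_pos.2 ⟨j, by simp [hj]⟩
  refine ArcAdj.lift ?_ ?_ ?_ ?_ h
  · intro m
    rw [curveOf_joinArc, curveOf_joinArc]
  · exact fun e j hj => curveOf_sides L s _ (hpos e j hj)
  · exact fun e j hj => curveOf_sides L s _ (hpos e j hj)
  · exact fun e j t hj => curveOf_congr L s t (cutsBefore_succ_of_not_cut hj).symm

theorem mk_joinArc (L : TreeLabels) (s : (Σ e : Edge, Fin (L.len e)) → Bool)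
    (m : Fin 4 × Fin 3) (k : Fin 2) :
    Quot.mk (L.ArcAdj s) (L.joinArc m k) = Quot.mk (L.ArcAdj s) (L.joinArc m 0) := by
  fin_cases k
  · rfl
  · exact (Quot.sound (r := L.ArcAdj s) (Or.inl ⟨m, rfl, rfl⟩)).symm

theorem mk_lowJoin (L : TreeLabels) (s : (Σ e : Edge, Fin (L.len e)) → Bool) (e : Edge)
    (t : Bool) :
    Quot.mk (L.ArcAdj s) (L.joinArc (lowJoin e t).1 0) = Quot.mk (L.ArcAdj s) (⟨e, 0⟩, t) := by
  have h := L.endArc_lowEnd (⟨e, 0⟩, t)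
  rw [lowEnd_zero] at h
  rw [← mk_joinArc L s _ (lowJoin e t).2]
  exact congrArg _ h

theorem mk_highJoin (L : TreeLabels) (s : (Σ e : Edge, Fin (L.len e)) → Bool) (e : Edge)
    (t : Bool) :
    Quot.mk (L.ArcAdj s) (L.joinArc (highJoin e t).1 0) =
      Quot.mk (L.ArcAdj s) (⟨e, Fin.last _⟩, t) := by
  have h := L.endArc_highEnd (⟨e, Fin.last _⟩, t)
  rw [highEnd_last] at h
  rw [← mk_joinArc L s _ (highJoin e t).2]
  exact congrArg _ h

theorem mk_joinArc_sound (L : TreeLabels) (s : (Σ e : Edge, Fin (L.len e)) → Bool)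
    {x y : Fin 4 × Fin 3} (h : BandAdj (L.cutBands s) x y) :
    Quot.mk (L.ArcAdj s) (L.joinArc x 0) = Quot.mk (L.ArcAdj s) (L.joinArc y 0) := by
  obtain ⟨e, t, h⟩ := h
  by_cases hb : 0 < cuts (L.cutAt s e)
  · cases t <;> simp only [strand, cutBands, hb, decide_true, Prod.mk.injEq] at h <;>
      rw [← h.1, ← h.2]
    · rw [mk_highJoin, mk_highJoin, mk_sides_eq hb]
    · rw [mk_lowJoin, mk_lowJoin, mk_sides_eq hb]
  · simp only [strand, cutBands, hb, decide_false, Prod.mk.injEq] at h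
    rw [← h.1, ← h.2, mk_lowJoin, mk_highJoin]
    refine mk_level_eq ?_ t
    rw [cutsBefore_zero, cutsBefore_last]
    omega

theorem exists_level (L : TreeLabels) (s : (Σ e : Edge, Fin (L.len e)) → Bool)
    (x : Σ e : Edge, Fin (cuts (L.cutAt s e) - 1)) :
    ∃ i : Fin (L.len x.1 + 1), cutsBefore (L.cutAt s x.1) i = x.2 + 1 := by
  -- The circle with index `x.2`, counted from 0, lies after `x.2 + 1` cuts.
  obtain ⟨j, -, hj⟩ := exists_cut (L.cutAt s x.1) (m := x.2 + 1) (by omega)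
  exact ⟨_, hj⟩

/-- The closed curves of a state are those that are obtained by cutting bands, and those that lie
between two cuts of a band. -/
noncomputable def curveEquiv (L : TreeLabels) (s : (Σ e : Edge, Fin (L.len e)) → Bool) :
    Quot (L.ArcAdj s) ≃
      Quot (BandAdj (L.cutBands s)) ⊕ Σ e : Edge, Fin (cuts (L.cutAt s e) - 1) where
  toFun := Quot.lift (L.curveOf s) fun _ _ => L.curveOf_sound s
  invFun := Sum.elim
    (Quot.lift (fun x => Quot.mk _ (L.joinArc x 0)) fun _ _ => L.mk_joinArc_sound s)
    fun x => Quot.mk _ (⟨x.1, (L.exists_level s x).choose⟩, true)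
  left_inv := fun x => by
    induction x using Quot.ind with
    | mk x =>
    obtain ⟨⟨e, i⟩, t⟩ := x
    change Sum.elim _ _ (L.curveOf s _) = _
    by_cases h0 : cutsBefore (L.cutAt s e) i = 0
    · rw [curveOf_low L s _ h0]
      refine (mk_lowJoin L s e t).trans (mk_level_eq ?_ t)
      rw [h0, cutsBefore_zero]
    by_cases h1 : cutsBefore (L.cutAt s e) i = cuts (L.cutAt s e)
    · rw [curveOf_high L s _ h1]
      refine (mk_highJoin L s e t).trans (mk_level_eq ?_ t)
      rw [h1, cutsBefore_last]
    · have h2 := cutsBefore_le (L.cutAt s e) i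
      have h3 : 0 < cutsBefore (L.cutAt s e) i ∧
        cutsBefore (L.cutAt s e) i < cuts (L.cutAt s e) := by omega
      simp only [curveOf, dif_pos h3, Sum.elim_inr]
      have h4 := (L.exists_level s ⟨e, cutsBefore (L.cutAt s e) i - 1, by omega⟩).choose_spec
      have h5 := mk_level_eq (h4.trans (Nat.sub_add_cancel h3.1)) true
      refine h5.trans ?_
      cases t
      · exact mk_sides_eq (h3.1.trans h3.2) i
      · rfl
  right_inv := fun x => by
    rcases x with x | x
    · induction x using Quot.ind
      exact curveOf_joinArc L s _ 0
    · have h := (L.exists_level s x).choose_spec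
      have h2 := x.2.2
      have h3 : 0 < cutsBefore (L.cutAt s x.1) (L.exists_level s x).choose ∧
        cutsBefore (L.cutAt s x.1) (L.exists_level s x).choose < cuts (L.cutAt s x.1) := by omega
      refine (dif_pos h3).trans ?_
      simp only [h, Nat.add_sub_cancel]

/-- The number of closed curves of a state. -/
theorem loops_eq (L : TreeLabels) (s : (Σ e : Edge, Fin (L.len e)) → Bool) :
    L.diagram.loops s =
      Nat.card (Quot (BandAdj (L.cutBands s))) + ∑ e, (cuts (L.cutAt s e) - 1) := by
  rw [loops_eq_card, Nat.card_congr (L.curveEquiv s), Nat.card_sum, Nat.card_sigma]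
  simp

end TreeLabels

/-! ### Counting the classes of a relation by merging labels -/

/-- The labels `f` tell apart the classes of the equivalence relation generated by `E`. -/
def IsLabelling {α β : Type*} (E : List (β × β)) (f : β → α) : Prop :=
  ∀ x y, f x = f y ↔ Relation.EqvGen (fun u v => (u, v) ∈ E) x y

theorem isLabelling_nil {α β : Type*} {f : β → α} (hf : Function.Injective f) :
    IsLabelling [] f := fun x y => by
  refine ⟨fun h => hf h ▸ Relation.EqvGen.refl _, fun h => ?_⟩
  induction h with
  | rel _ _ h => simp at h
  | refl => rfl
  | symm _ _ _ ih => exact ih.symm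
  | trans _ _ _ _ _ ih ih' => exact ih.trans ih'

/-- Adding the pair `(u, v)` unites two classes, so every occurrence of the label of `u` is
overwritten by that of `v`. -/
theorem IsLabelling.cons {α β : Type*} [DecidableEq α] {E : List (β × β)} {f : β → α}
    (hf : IsLabelling E f) (u v : β) :
    IsLabelling ((u, v) :: E) (fun w => if f w = f u then f v else f w) := fun x y => by
  have mono : ∀ {x y}, f x = f y → Relation.EqvGen (fun a b => (a, b) ∈ (u, v) :: E) x y :=
    fun h => Relation.EqvGen.mono (fun _ _ h => List.mem_cons_of_mem _ h) _ _ ((hf _ _).1 h)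
  have huv : Relation.EqvGen (fun a b => (a, b) ∈ (u, v) :: E) u v :=
    Relation.EqvGen.rel _ _ (by simp)
  constructor
  · intro h
    by_cases hx : f x = f u <;> by_cases hy : f y = f u <;> simp only [hx, hy, if_true, if_false] at h
    · exact mono (hx.trans hy.symm)
    · exact ((mono hx).trans _ _ _ huv).trans _ _ _ (mono h)
    · exact (mono h).trans _ _ _ (huv.symm.trans _ _ _ (mono hy.symm))
    · exact mono h
  · intro h
    induction h with
    | rel x y h =>
      rcases List.mem_cons.1 h with h | h
      · obtain ⟨rfl, rfl⟩ := Prod.mk.inj h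
        simp
      · have : f x = f y := (hf _ _).2 (Relation.EqvGen.rel _ _ h)
        simp only [this]
    | refl => rfl
    | symm _ _ _ ih => exact ih.symm
    | trans _ _ _ _ _ ih ih' => exact ih.trans ih'

theorem IsLabelling.card_quot {α β : Type*} [Fintype β] [DecidableEq α] {E : List (β × β)}
    {f : β → α} (hf : IsLabelling E f) {r : β → β → Prop} (hr : ∀ u v, r u v ↔ (u, v) ∈ E) :
    Nat.card (Quot r) = (Finset.univ.image f).card := by
  have hr' : r = fun u v => (u, v) ∈ E := by ext u v; exact hr u v
  subst hr'
  let g : Quot (fun u v => (u, v) ∈ E) → α :=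
    Quot.lift f fun x y h => (hf x y).2 (Relation.EqvGen.rel _ _ h)
  have hg : Function.Injective g := fun x y => by
    induction x using Quot.ind
    induction y using Quot.ind
    exact fun h => Quot.eqvGen_sound ((hf _ _).1 h)
  rw [Nat.card_congr (Equiv.ofInjective g hg), Nat.card_coe_set_eq, Set.range_quot_lift,
    ← Set.ncard_coe_finset]
  simp

/-! ### The patterns of cut bands -/

namespace TreeLabels

/-- A numbering of the joins. -/
def joinIndex (x : Fin 4 × Fin 3) : ℕ := 3 * x.1 + x.2

/-- The table of labels after merging along the pairs in a list. -/
def labelTable : List ((Fin 4 × Fin 3) × (Fin 4 × Fin 3)) → List ℕ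
  | [] => List.range 12
  | (u, v) :: E =>
    (labelTable E).map fun n =>
      bif n == (labelTable E).getD (joinIndex u) 0 then (labelTable E).getD (joinIndex v) 0 else n

theorem joinIndex_lt (x : Fin 4 × Fin 3) : joinIndex x < 12 := by
  have := x.1.2
  have := x.2.2
  unfold joinIndex
  omega

theorem length_labelTable (E : List ((Fin 4 × Fin 3) × (Fin 4 × Fin 3))) :
    (labelTable E).length = 12 := by
  induction E with
  | nil => rfl
  | cons _ _ ih => simpa [labelTable] using ih

theorem isLabelling_labelTable (E : List ((Fin 4 × Fin 3) × (Fin 4 × Fin 3))) :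
    IsLabelling E fun x => (labelTable E).getD (joinIndex x) 0 := by
  induction E with
  | nil => exact isLabelling_nil (by decide)
  | cons p E ih =>
    convert ih.cons p.1 p.2 using 2 with x
    have hx : joinIndex x < (labelTable E).length := by
      rw [length_labelTable]; exact joinIndex_lt x
    simp [labelTable, hx, Bool.cond_eq_ite]

theorem image_labelTable (E : List ((Fin 4 × Fin 3) × (Fin 4 × Fin 3))) :
    Finset.univ.image (fun x => (labelTable E).getD (joinIndex x) 0) =
      (labelTable E).toFinset := by
  ext n
  simp only [Finset.mem_image, Finset.mem_univ, true_and, List.mem_toFinset]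
  constructor
  · rintro ⟨x, rfl⟩
    have hx : joinIndex x < (labelTable E).length := by
      rw [length_labelTable]; exact joinIndex_lt x
    rw [List.getD_eq_getElem _ _ hx]
    exact List.getElem_mem hx
  · intro h
    obtain ⟨i, hi, rfl⟩ := List.getElem_of_mem h
    have hi' : i < 12 := length_labelTable E ▸ hi
    refine ⟨(⟨i / 3, by omega⟩, ⟨i % 3, by omega⟩), ?_⟩
    have : joinIndex (⟨i / 3, by omega⟩, ⟨i % 3, by omega⟩) = i := by
      simp only [joinIndex]; omega
    rw [this, List.getD_eq_getElem _ _ hi]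

/-- The list of the strands of a state of the bands. -/
def strands (S : Edge → Bool) : List ((Fin 4 × Fin 3) × (Fin 4 × Fin 3)) :=
  [Sum.inl 0, Sum.inl 1, Sum.inl 2, Sum.inr 0, Sum.inr 1, Sum.inr 2].flatMap fun e =>
    [strand S e true, strand S e false]

theorem bandAdj_iff (S : Edge → Bool) (x y : Fin 4 × Fin 3) :
    BandAdj S x y ↔ (x, y) ∈ strands S := by
  simp only [BandAdj, strands, List.mem_flatMap]
  constructor
  · rintro ⟨e, t, h⟩
    refine ⟨e, ?_, ?_⟩
    · rcases e with i | i <;> fin_cases i <;> simp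
    · cases t <;> simp [h]
  · rintro ⟨e, -, h⟩
    simp only [List.mem_cons, List.not_mem_nil, or_false] at h
    rcases h with h | h
    · exact ⟨e, _, h.symm⟩
    · exact ⟨e, _, h.symm⟩

/-- The number of closed curves after cutting some of the bands, diminished by one. -/
def bandLoops (x y z u v w : Bool) : ℕ :=
  let i := x.toNat + y.toNat + z.toNat
  let j := u.toNat + v.toNat + w.toNat
  i + j - 2 * min i (min j 2) +
    bif i == 1 && j == 1 && (x && v || y && w || z && u) then 2 else 0

/-- A finite check of the 64 patterns, which the kernel can evaluate because `labelTable` computes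
with lists of numbers. -/
theorem card_toFinset_labelTable : ∀ x y z u v w : Bool,
    (labelTable (strands (Sum.elim ![x, y, z] ![u, v, w]))).toFinset.card =
      bandLoops x y z u v w + 1 := by
  decide +kernel

theorem card_bandAdj (x y z u v w : Bool) :
    Nat.card (Quot (BandAdj (Sum.elim ![x, y, z] ![u, v, w]))) = bandLoops x y z u v w + 1 := by
  rw [(isLabelling_labelTable _).card_quot (bandAdj_iff _), image_labelTable,
    card_toFinset_labelTable]

end TreeLabels

namespace TreeLabels

open LaurentPolynomial (T)

/-! ### The state sum -/

/-- The factor of the bracket for a closed curve. -/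
noncomputable def loopValue : ℤ[T;T⁻¹] := -T 2 - T (-2)

/-- The contribution of a band with `n` half twists to the bracket from the states that cut it
(`x = true`) or leave it uncut (`x = false`). -/
noncomputable def bandSum (n : ℤ) (x : Bool) : ℤ[T;T⁻¹] :=
  ∑ b : Fin n.natAbs → Bool,
    if decide (0 < cuts fun j => b j == decide (0 < n)) = x then
      T (∑ j, if b j then 1 else -1) * loopValue ^ ((cuts fun j => b j == decide (0 < n)) - 1)
    else 0

theorem T_sum {ι : Type*} (s : Finset ι) (f : ι → ℤ) :
    (T (∑ i ∈ s, f i) : ℤ[T;T⁻¹]) = ∏ i ∈ s, T (f i) := by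
  classical
  induction s using Finset.induction_on with
  | empty => simp
  | insert i s hi ih => rw [Finset.sum_insert hi, Finset.prod_insert hi, LaurentPolynomial.T_add, ih]

theorem prod_ite_eq_apply {ι R : Type*} [Fintype ι] [CommSemiring R] (P S : ι → Bool)
    (f : ι → R) : ∏ i, (if P i = S i then f i else 0) = if P = S then ∏ i, f i else 0 := by
  by_cases h : P = S
  · simp [h]
  · obtain ⟨i, hi⟩ := Function.ne_iff.1 h
    rw [if_neg h]
    exact Finset.prod_eq_zero (Finset.mem_univ i) (if_neg hi)

theorem bracket_eq_sum (L : TreeLabels) :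
    L.diagram.bracket = ∑ s : (Σ e : Edge, Fin (L.len e)) → Bool,
      T (∑ c, if s c then 1 else -1) * loopValue ^ (L.diagram.loops s - 1) := rfl

theorem bracket_eq_sum_bands (L : TreeLabels) :
    L.diagram.bracket = ∑ S : Edge → Bool, (∏ e, bandSum (L.twist e) (S e)) *
      loopValue ^ (Nat.card (Quot (BandAdj S)) - 1) := by
  -- Expanding the product of the band sums gives a sum over families of band states, which are the
  -- states of the diagram. For each of them only the pattern `S` of the bands that it cuts
  -- contributes.
  simp only [bandSum, Fintype.prod_sum, Finset.sum_mul]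
  rw [Finset.sum_comm, bracket_eq_sum]
  refine Fintype.sum_equiv (Equiv.piCurry fun _ _ => Bool) _ _ fun s => ?_
  have hS : ∀ S : Edge → Bool, (∏ e, if decide (0 < cuts (L.cutAt s e)) = S e then
      T (∑ j, if s ⟨e, j⟩ then 1 else -1) * loopValue ^ (cuts (L.cutAt s e) - 1) else 0) *
        loopValue ^ (Nat.card (Quot (BandAdj S)) - 1) =
      if L.cutBands s = S then (∏ e, (T (∑ j, if s ⟨e, j⟩ then 1 else -1) *
        loopValue ^ (cuts (L.cutAt s e) - 1))) *
        loopValue ^ (Nat.card (Quot (BandAdj S)) - 1) else 0 := fun S => by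
    rw [prod_ite_eq_apply (fun e => decide (0 < cuts (L.cutAt s e))), ite_mul, zero_mul]
    rfl
  refine Eq.trans ?_ (Finset.sum_congr rfl fun S _ => (hS S).symm)
  rw [Finset.sum_ite_eq, if_pos (Finset.mem_univ _), loops_eq, Fintype.sum_sigma, T_sum,
    Finset.prod_mul_distrib, Finset.prod_pow_eq_pow_sum, mul_assoc, ← pow_add]
  -- At least one curve runs through joins, so the truncated `- 1` can be taken from the first
  -- summand of `loops_eq`.
  have hpos : 0 < Nat.card (Quot (BandAdj (L.cutBands s))) :=
    Nat.card_pos_iff.2 ⟨⟨Quot.mk _ 0⟩, inferInstance⟩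
  congr 2
  omega

theorem sum_edges {M : Type*} [AddCommMonoid M] (f : (Edge → Bool) → M) :
    ∑ S, f S = ∑ x, ∑ y, ∑ z, ∑ u, ∑ v, ∑ w, f (Sum.elim ![x, y, z] ![u, v, w]) := by
  have hb : Function.Bijective fun x : Bool × Bool × Bool × Bool × Bool × Bool =>
      (Sum.elim ![x.1, x.2.1, x.2.2.1] ![x.2.2.2.1, x.2.2.2.2.1, x.2.2.2.2.2] : Edge → Bool) := by
    constructor
    · rintro ⟨x, y, z, u, v, w⟩ ⟨x', y', z', u', v', w'⟩ h
      have h' := congrFun h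
      simpa [Fin.forall_fin_succ, and_assoc] using h'
    · intro S
      refine ⟨(S (Sum.inl 0), S (Sum.inl 1), S (Sum.inl 2), S (Sum.inr 0), S (Sum.inr 1),
        S (Sum.inr 2)), ?_⟩
      ext (i | i) <;> fin_cases i <;> rfl
  rw [← hb.sum_comp]
  simp only [Fintype.sum_prod_type]

/-- The sum over the states of six bands, with weights for cut and uncut bands. -/
noncomputable def bandStateSum (f g h k l m : Bool → ℤ[T;T⁻¹]) : ℤ[T;T⁻¹] :=
  ∑ x, ∑ y, ∑ z, ∑ u, ∑ v, ∑ w, f x * g y * h z * k u * l v * m w *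
    loopValue ^ bandLoops x y z u v w

theorem bracket_eq (p q r a b c : ℤ) :
    (TreeLabels.mk p q r a b c).diagram.bracket = bandStateSum (bandSum p) (bandSum q)
      (bandSum r) (bandSum a) (bandSum b) (bandSum c) := by
  rw [bracket_eq_sum_bands, sum_edges, bandStateSum]
  simp only [card_bandAdj, Nat.add_sub_cancel]
  simp [Fin.prod_univ_three, twist, mul_assoc]

/-! ### The weights of a single band -/

theorem bandSum_false (n : ℤ) : bandSum n false = T (-n) := by
  rw [bandSum, Finset.sum_eq_single fun _ => !decide (0 < n)]
  · by_cases hn : 0 < n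
    · simp [cuts, hn, abs_of_pos hn]
    · simp [cuts, hn, abs_of_nonpos (not_lt.1 hn)]
  · intro b _ hb
    obtain ⟨j, hj⟩ := Function.ne_iff.1 hb
    have : 0 < cuts fun j => b j == decide (0 < n) :=
      Finset.card_pos.2 ⟨j, by
        simp only [Finset.mem_filter, Finset.mem_univ, true_and]
        cases h : b j <;> cases h' : decide (0 < n) <;> simp_all⟩
    simp [this]
  · simp

/-- In this combination every state, the uncut one included, carries δ to the number of its cuts, so
the sum factors over the crossings. A crossing contributes Aδ + A⁻¹ = -A³, or A + A⁻¹δ = -A⁻³ if the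
label is negative; evenness removes the sign. -/
theorem loopValue_mul_bandSum_true (n : ℤ) (hn : Even n) :
    loopValue * bandSum n true + bandSum n false = T (3 * n) := by
  have h1 : loopValue * bandSum n true + bandSum n false = ∑ b : Fin n.natAbs → Bool,
      ∏ j, (T (if b j then 1 else -1) * if b j == decide (0 < n) then loopValue else 1) := by
    rw [bandSum, bandSum, Finset.mul_sum, ← Finset.sum_add_distrib]
    refine Finset.sum_congr rfl fun b _ => ?_
    rw [Finset.prod_mul_distrib, ← T_sum, Finset.prod_ite, Finset.prod_const, Finset.prod_const_one,
      mul_one]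
    change _ = _ * loopValue ^ (cuts fun j => b j == decide (0 < n))
    rcases Nat.eq_zero_or_pos (cuts fun j => b j == decide (0 < n)) with h | h
    · simp [h]
    · simp only [h, decide_true, if_true, Bool.true_eq_false, if_false, add_zero]
      obtain ⟨k, hk⟩ := Nat.exists_eq_add_of_lt h
      rw [hk]
      simp only [zero_add, Nat.add_sub_cancel, pow_succ]
      ring
  rw [h1, ← Fintype.prod_sum fun (_ : Fin n.natAbs) (x : Bool) =>
    (T (if x then 1 else -1) * if x == decide (0 < n) then loopValue else 1 : ℤ[T;T⁻¹])]
  have hev : Even n.natAbs := Int.natAbs_even.2 hn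
  rw [Finset.prod_const, Finset.card_univ, Fintype.card_fin, Fintype.sum_bool]
  by_cases h : 0 < n
  · have h2 : (T 1 * loopValue + T (-1) : ℤ[T;T⁻¹]) = -T 3 := by
      rw [loopValue, mul_sub, mul_neg, ← LaurentPolynomial.T_add, ← LaurentPolynomial.T_add]
      norm_num
    simp only [h, decide_true, beq_self_eq_true, if_true, Bool.false_eq_true, if_false,
      mul_one, show (false == true) = false from rfl]
    rw [h2, hev.neg_pow, LaurentPolynomial.T_pow, Int.natCast_natAbs, abs_of_pos h, mul_comm]
  · have h2 : (T 1 + T (-1) * loopValue : ℤ[T;T⁻¹]) = -T (-3) := by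
      rw [loopValue, mul_sub, mul_neg, ← LaurentPolynomial.T_add, ← LaurentPolynomial.T_add]
      norm_num
      ring
    simp only [h, decide_false, beq_self_eq_true, if_true, Bool.false_eq_true, if_false,
      mul_one, show (true == false) = false from rfl]
    rw [h2, hev.neg_pow, LaurentPolynomial.T_pow, Int.natCast_natAbs,
      abs_of_nonpos (not_lt.1 h)]
    congr 1
    ring

theorem T_injective : Function.Injective (T : ℤ → ℤ[T;T⁻¹]) := fun m n h => by
  have h1 := LaurentPolynomial.degree_T (R := ℤ) m
  rw [h, LaurentPolynomial.degree_T] at h1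
  exact (WithBot.coe_injective h1).symm

/-- Multiplication by δ turns the left side into `T (3 * m - n) - T (3 * n - m)`. -/
theorem bandSum_cross_eq_iff {m n : ℤ} (hm : Even m) (hn : Even n) :
    bandSum m true * bandSum n false - bandSum n true * bandSum m false = 0 ↔ m = n := by
  refine ⟨fun h => ?_, fun h => by rw [h, sub_self]⟩
  have h1 := loopValue_mul_bandSum_true m hm
  have h2 := loopValue_mul_bandSum_true n hn
  rw [bandSum_false] at h1 h2
  rw [bandSum_false, bandSum_false] at h
  have h3 : (T (3 * m - n) : ℤ[T;T⁻¹]) = T (3 * n - m) := by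
    rw [sub_eq_add_neg, sub_eq_add_neg, LaurentPolynomial.T_add, LaurentPolynomial.T_add]
    linear_combination loopValue * h - h1 * T (-n) + h2 * T (-m)
  have := T_injective h3
  omega

theorem loopValue_sq_sub_one_ne_zero : loopValue ^ 2 - 1 ≠ 0 := by
  intro h
  have h1 : loopValue ^ 2 - 1 = T 4 + T (-4) + 1 := by
    have h2 : (T 2 * T (-2) : ℤ[T;T⁻¹]) = 1 := by rw [← LaurentPolynomial.T_add]; simp
    have h4 : (T 4 : ℤ[T;T⁻¹]) = T 2 * T 2 := by rw [← LaurentPolynomial.T_add]; norm_num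
    have h5 : (T (-4) : ℤ[T;T⁻¹]) = T (-2) * T (-2) := by
      rw [← LaurentPolynomial.T_add]; norm_num
    rw [loopValue, h4, h5]
    linear_combination 2 * h2
  rw [h1, ← LaurentPolynomial.T_zero] at h
  have := congrArg (fun f : ℤ[T;T⁻¹] => f.coeff 4) h
  simp [-LaurentPolynomial.T_zero] at this

end TreeLabels

namespace TreeLabels

open LaurentPolynomial (T)

/-! ### Transposing two outer labels -/

/-- Only the extra term of `bandLoops` for opposite bands is not symmetric in the outer bands; it
replaces 1 by δ². The exchange affects two opposite pairs, A₀ with B₁ and A₂ with B₀, and their four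
terms factor. -/
theorem bandStateSum_swap_zero_one (f g h k l m : Bool → ℤ[T;T⁻¹]) :
    bandStateSum f g h k l m - bandStateSum f g h l k m = (loopValue ^ 2 - 1) *
      (g false * m false) * (f true * h false - h true * f false) *
        (l true * k false - k true * l false) := by
  simp only [bandStateSum, Fintype.sum_bool]
  simp [bandLoops]
  ring

theorem bandStateSum_swap_one_two (f g h k l m : Bool → ℤ[T;T⁻¹]) :
    bandStateSum f g h k l m - bandStateSum f g h k m l = (loopValue ^ 2 - 1) *
      (h false * k false) * (f true * g false - g true * f false) *
        (l true * m false - m true * l false) := by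
  simp only [bandStateSum, Fintype.sum_bool]
  simp [bandLoops]
  ring

theorem bandStateSum_swap_zero_two (f g h k l m : Bool → ℤ[T;T⁻¹]) :
    bandStateSum f g h k l m - bandStateSum f g h m l k = (loopValue ^ 2 - 1) *
      (f false * l false) * (g true * h false - h true * g false) *
        (m true * k false - k true * m false) := by
  simp only [bandStateSum, Fintype.sum_bool]
  simp [bandLoops]
  ring

/-- Laurent polynomials over ℤ form a domain, the uncut weights are units, and δ² - 1 is not zero,
so only the last two factors can vanish. -/
theorem eq_iff_of_sub_eq {f g : ℤ[T;T⁻¹]} {k l m n m' n' : ℤ} (hm : Even m) (hn : Even n)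
    (hm' : Even m') (hn' : Even n')
    (h : f - g = (loopValue ^ 2 - 1) * (bandSum k false * bandSum l false) *
      (bandSum m true * bandSum n false - bandSum n true * bandSum m false) *
        (bandSum m' true * bandSum n' false - bandSum n' true * bandSum m' false)) :
    f = g ↔ m = n ∨ m' = n' := by
  rw [← sub_eq_zero, h, mul_eq_zero, mul_eq_zero, mul_eq_zero, bandSum_cross_eq_iff hm hn,
    bandSum_cross_eq_iff hm' hn', bandSum_false k, bandSum_false l]
  have h1 := loopValue_sq_sub_one_ne_zero
  have h2 : (T (-k) * T (-l) : ℤ[T;T⁻¹]) ≠ 0 :=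
    ((LaurentPolynomial.isUnit_T _).mul (LaurentPolynomial.isUnit_T _)).ne_zero
  simp only [h1, h2, or_self, false_or]

/-- The normalising factor is a unit determined by the writhe, and inverting the variable is
injective. -/
theorem jones_eq_iff_bracket_eq {D D' : LinkDiagram} {o : D.Orientation} {o' : D'.Orientation}
    (h : D.writhe o = D'.writhe o') : D.jones o = D'.jones o' ↔ D.bracket = D'.bracket := by
  rw [LinkDiagram.jones, LinkDiagram.jones, h, LaurentPolynomial.invert.injective.eq_iff]
  refine IsUnit.mul_right_inj (IsUnit.mul ?_ (LaurentPolynomial.isUnit_T _))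
  exact (Units.isUnit _).map LaurentPolynomial.C

theorem even_twist {p q r a b c : ℤ} (hp : Even p) (hq : Even q) (hr : Even r)
    (ha : Even a) (hb : Even b) (hc : Even c) (e : Edge) :
    Even ((TreeLabels.mk p q r a b c).twist e) := by
  rcases e with i | i <;> fin_cases i <;> assumption

theorem sum_twist (p q r a b c : ℤ) :
    ∑ e, (TreeLabels.mk p q r a b c).twist e = p + q + r + (a + b + c) := by
  simp [twist, Fin.sum_univ_three]

/-! ### The `D₃` relation and transpositions -/

/-- The products pair the labels of opposite edges on the circle, and rotation and reflection
preserve opposition. This invariant suffices to rule out a symmetry in all three cases below. -/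
theorem EqByD3.sum_mul_eq {L L' : TreeLabels} (h : EqByD3 L L') :
    L.p * L.b + L.q * L.c + L.r * L.a = L'.p * L'.b + L'.q * L'.c + L'.r * L'.a := by
  induction h with
  | rel _ _ h => cases h <;> ring
  | refl => rfl
  | symm _ _ _ ih => exact ih.symm
  | trans _ _ _ _ _ ih ih' => exact ih.trans ih'

theorem EqByD3.rotation (p q r a b c : ℤ) : EqByD3 ⟨p, q, r, a, b, c⟩ ⟨q, r, p, b, c, a⟩ :=
  Relation.EqvGen.rel _ _ (D3Step.rotation p q r a b c)

theorem EqByD3.reflection (p q r a b c : ℤ) : EqByD3 ⟨p, q, r, a, b, c⟩ ⟨p, r, q, c, b, a⟩ :=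
  Relation.EqvGen.rel _ _ (D3Step.reflection p q r a b c)

theorem eqByD3_swap_zero_one_iff (p q r a b c : ℤ) :
    EqByD3 ⟨p, q, r, a, b, c⟩ ⟨p, q, r, b, a, c⟩ ↔ p = r ∨ b = a := by
  constructor
  · intro h
    have h1 : (p - r) * (b - a) = 0 := by linear_combination h.sum_mul_eq
    exact (mul_eq_zero.1 h1).imp sub_eq_zero.1 sub_eq_zero.1
  · rintro (rfl | rfl)
    -- The reflection that exchanges A₀ with A₂ and B₀ with B₁ is the generating one followed by a
    -- rotation.
    · exact (EqByD3.reflection p q p a b c).trans _ _ _ (EqByD3.rotation p p q c b a)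
    · exact Relation.EqvGen.refl _

theorem eqByD3_swap_one_two_iff (p q r a b c : ℤ) :
    EqByD3 ⟨p, q, r, a, b, c⟩ ⟨p, q, r, a, c, b⟩ ↔ p = q ∨ b = c := by
  constructor
  · intro h
    have h1 : (p - q) * (b - c) = 0 := by linear_combination h.sum_mul_eq
    exact (mul_eq_zero.1 h1).imp sub_eq_zero.1 sub_eq_zero.1
  · rintro (rfl | rfl)
    · exact ((EqByD3.reflection p p r a b c).trans _ _ _ (EqByD3.rotation p r p c b a)).trans _ _ _
        (EqByD3.rotation r p p b a c)
    · exact Relation.EqvGen.refl _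

theorem eqByD3_swap_zero_two_iff (p q r a b c : ℤ) :
    EqByD3 ⟨p, q, r, a, b, c⟩ ⟨p, q, r, c, b, a⟩ ↔ q = r ∨ c = a := by
  constructor
  · intro h
    have h1 : (q - r) * (c - a) = 0 := by linear_combination h.sum_mul_eq
    exact (mul_eq_zero.1 h1).imp sub_eq_zero.1 sub_eq_zero.1
  · rintro (rfl | rfl)
    · exact EqByD3.reflection p q q a b c
    · exact Relation.EqvGen.refl _

/-! ### The three transpositions -/

section

variable {p q r a b c : ℤ}

theorem jones_swap_zero_one (hp : Even p) (hq : Even q) (hr : Even r)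
    (ha : Even a) (hb : Even b) (hc : Even c) (o : (TreeLabels.mk p q r a b c).diagram.Orientation)
    (o' : (TreeLabels.mk p q r b a c).diagram.Orientation) :
    (TreeLabels.mk p q r a b c).diagram.jones o = (TreeLabels.mk p q r b a c).diagram.jones o' ↔
      EqByD3 ⟨p, q, r, a, b, c⟩ ⟨p, q, r, b, a, c⟩ := by
  rw [jones_eq_iff_bracket_eq, eqByD3_swap_zero_one_iff, bracket_eq, bracket_eq]
  · exact eq_iff_of_sub_eq hp hr hb ha (bandStateSum_swap_zero_one _ _ _ _ _ _)
  · rw [writhe_eq _ _ (even_twist hp hq hr ha hb hc), writhe_eq _ _ (even_twist hp hq hr hb ha hc),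
      sum_twist, sum_twist]
    ring

theorem jones_swap_one_two (hp : Even p) (hq : Even q) (hr : Even r)
    (ha : Even a) (hb : Even b) (hc : Even c) (o : (TreeLabels.mk p q r a b c).diagram.Orientation)
    (o' : (TreeLabels.mk p q r a c b).diagram.Orientation) :
    (TreeLabels.mk p q r a b c).diagram.jones o = (TreeLabels.mk p q r a c b).diagram.jones o' ↔
      EqByD3 ⟨p, q, r, a, b, c⟩ ⟨p, q, r, a, c, b⟩ := by
  rw [jones_eq_iff_bracket_eq, eqByD3_swap_one_two_iff, bracket_eq, bracket_eq]
  · exact eq_iff_of_sub_eq hp hq hb hc (bandStateSum_swap_one_two _ _ _ _ _ _)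
  · rw [writhe_eq _ _ (even_twist hp hq hr ha hb hc), writhe_eq _ _ (even_twist hp hq hr ha hc hb),
      sum_twist, sum_twist]
    ring

theorem jones_swap_zero_two (hp : Even p) (hq : Even q) (hr : Even r)
    (ha : Even a) (hb : Even b) (hc : Even c) (o : (TreeLabels.mk p q r a b c).diagram.Orientation)
    (o' : (TreeLabels.mk p q r c b a).diagram.Orientation) :
    (TreeLabels.mk p q r a b c).diagram.jones o = (TreeLabels.mk p q r c b a).diagram.jones o' ↔
      EqByD3 ⟨p, q, r, a, b, c⟩ ⟨p, q, r, c, b, a⟩ := by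
  rw [jones_eq_iff_bracket_eq, eqByD3_swap_zero_two_iff, bracket_eq, bracket_eq]
  · exact eq_iff_of_sub_eq hq hr hc ha (bandStateSum_swap_zero_two _ _ _ _ _ _)
  · rw [writhe_eq _ _ (even_twist hp hq hr ha hb hc), writhe_eq _ _ (even_twist hp hq hr hc hb ha),
      sum_twist, sum_twist]
    ring

end

theorem isSwap_fin_three {τ : Equiv.Perm (Fin 3)} (h : τ.IsSwap) :
    τ = Equiv.swap 0 1 ∨ τ = Equiv.swap 1 2 ∨ τ = Equiv.swap 0 2 := by
  obtain ⟨i, j, hij, rfl⟩ := h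
  revert i j
  decide

end TreeLabels

theorem lemma4p7 (p q r a b c : ℤ) (hp : Even p) (hq : Even q) (hr : Even r)
    (ha : Even a) (hb : Even b) (hc : Even c) (τ : Equiv.Perm (Fin 3)) (hτ : τ.IsSwap)
    (o : (TreeLabels.mk p q r a b c).diagram.Orientation)
    (o' : (TreeLabels.mk p q r
      (![a, b, c] (τ 0)) (![a, b, c] (τ 1)) (![a, b, c] (τ 2))).diagram.Orientation) :
    (TreeLabels.mk p q r a b c).diagram.jones o =
        (TreeLabels.mk p q r
          (![a, b, c] (τ 0)) (![a, b, c] (τ 1)) (![a, b, c] (τ 2))).diagram.jones o' ↔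
      TreeLabels.EqByD3 (TreeLabels.mk p q r a b c)
        (TreeLabels.mk p q r (![a, b, c] (τ 0)) (![a, b, c] (τ 1)) (![a, b, c] (τ 2))) := by
  rcases TreeLabels.isSwap_fin_three hτ with rfl | rfl | rfl
  -- For a concrete swap the entries `![a, b, c] (τ i)` reduce by computation, so the types of the
  -- diagram and of `o'` match definitionally.
  · exact TreeLabels.jones_swap_zero_one hp hq hr ha hb hc o o'
  · exact TreeLabels.jones_swap_one_two hp hq hr ha hb hc o o'
  · exact TreeLabels.jones_swap_zero_two hp hq hr ha hb hc o o'
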